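/- Let $q\ge 2$ be real and let $Z_1,\dots,Z_n$ be independent real random variables with $\mathbb E[Z_i]=0$, $\mathbb E[Z_i^2]=1$ and $\mathbb E|Z_i|^q<\infty$. Let $(a_S)_{S\subseteq[n]}$ be real numbers and put $$f=\sum_{S\subseteq[n]}a_S\prod_{i\in S}Z_i,\qquad T_\rho f=\sum_{S\subseteq[n]}\rho^{|S|}a_S\prod_{i\in S}Z_i,\qquad D_Sf=\sum_{R\supseteq S}a_R\prod_{i\in R\setminus S}Z_i .$$ For positive reals $\sigma_1,\dots,\sigma_n$ write $\sigma_S=\prod_{i\in S}\sigma_i$ and $I_S[f]=\|\sigma_S^{-1}D_Sf\|_2^2$. (1) Suppose that $\sigma>0$ and $\mathbb E|Z_i|^q\le\sigma^{2-q}$ for all $i$. If $|\rho|<\frac1{2q^{3/2}}$, then $$\|T_\rho f\|_q^q\le\sum_{S\subseteq[n]}\sigma^{(2-q)|S|}\,\|D_Sf\|_2^q .$$ (2) In the setting of (1), with $\sigma_i=\sigma$ for all $i$ (so that $I_S[f]=\sigma^{-2|S|}\|D_Sf\|_2^2$), suppose that $|\rho|\le(2q)^{-3/2}$, $\beta>0$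 and $I_S[f]\le\beta\|f\|_2^2$ for all $S\subseteq[n]$. Then $\|T_\rho f\|_q\le\beta^{\frac{q-2}{2q}}\|f\|_2$. (3) Suppose that $\sigma_i>0$ and $\mathbb E|Z_i|^q\le\sigma_i^{2-q}$ for each $i$ (for instance with equality). If $|\rho|\le(2q)^{-3/2}$, then $$\|T_\rho f\|_q^q\le\sum_{S\subseteq[n]}\sigma_S^{2-q}\,\|D_Sf\|_2^q .$$ (4) In the setting of (3), suppose that $|\rho|\le(2q)^{-3/2}$, $\beta>0$ and $I_S[f]\le\beta\|f\|_2^2$ for all $S\subseteq[n]$. Then $\|T_\rho f\|_q\le\beta^{\frac{q-2}{2q}}\|f\|_2$. -/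

import Mathlib

open MeasureTheory ProbabilityTheory
open scoped ENNReal

noncomputable section

namespace GenHyper

/-- The multilinear random variable `f = ∑_S a_S ∏_{i ∈ S} Z_i`. -/
def multilin {Ω : Type*} {n : ℕ} (Z : Fin n → Ω → ℝ) (a : Finset (Fin n) → ℝ) : Ω → ℝ :=
  fun ω => ∑ S : Finset (Fin n), a S * ∏ i ∈ S, Z i ω

/-- The noise operator `T_ρ f = ∑_S ρ^|S| a_S ∏_{i ∈ S} Z_i`. -/
def noise {Ω : Type*} {n : ℕ} (ρ : ℝ) (Z : Fin n → Ω → ℝ) (a : Finset (Fin n) → ℝ) : Ω → ℝ :=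
  fun ω => ∑ S : Finset (Fin n), ρ ^ S.card * a S * ∏ i ∈ S, Z i ω

/-- The generalised derivative `D_T f = ∑_{S ⊇ T} a_S ∏_{i ∈ S \ T} Z_i`. -/
def genDeriv {Ω : Type*} {n : ℕ} (T : Finset (Fin n)) (Z : Fin n → Ω → ℝ)
    (a : Finset (Fin n) → ℝ) : Ω → ℝ :=
  fun ω => ∑ S : Finset (Fin n) with T ⊆ S, a S * ∏ i ∈ S \ T, Z i ω

/-- The generalised influence `I_S[f] = ‖σ_S⁻¹ D_S f‖₂²`, where `σ_S = ∏_{i ∈ S} σ_i`. -/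
def genInfluence {Ω : Type*} [MeasurableSpace Ω] (μ : Measure Ω) {n : ℕ} (σ : Fin n → ℝ)
    (S : Finset (Fin n)) (Z : Fin n → Ω → ℝ) (a : Finset (Fin n) → ℝ) : ℝ≥0∞ :=
  eLpNorm (fun ω => (∏ i ∈ S, σ i)⁻¹ * genDeriv S Z a ω) 2 μ ^ 2

end GenHyper

end

namespace GenHyper

open scoped RealInnerProductSpace

/-! The variables are removed one at a time, with coefficients in an inner product space. Isolating
`Z i` writes the noisy polynomial as `X + ρ Z Y`. In a second-order expansion of its `q`-th power
the linear term has mean zero, the quadratic term is absorbed by `(‖X‖² + ‖Y‖²)^(q/2)`, and the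
remainder costs `E|Z|^q · E‖Y‖^q` (`integral_norm_add_smul_rpow_le`). Both resulting terms are
moments of noisy polynomials in fewer variables, one with paired coefficients in `H × H`, the other
with those of the derivative, so induction applies (`integral_norm_noise_rpow_le`). The branch that
differentiates exactly along `S` ends with the `ℓ²` norm of `(a R)` over `R ⊇ S`, which is `‖D_S
f‖₂` by Parseval.

For small influences, the stricter bound on `ρ` leaves a spare factor `√2`, spent on damping `a R`
by `2^(-|R|/2)`. All but one factor of each squared norm is bounded through its influence; the
remaining damped squared norms sum over `S` to exactly `‖f‖₂²`. -/

/-! ### Pointwise inequalities -/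

theorem one_add_two_mul_add_sq_rpow_le {q : ℝ} (hq : 2 ≤ q) {c t : ℝ} (ht : 0 ≤ t)
    (hc : |c| ≤ t) :
    (1 + 2 * c + t ^ 2) ^ (q / 2) ≤ 1 + q * c + 2 * q ^ 2 * t ^ 2 + (2 * q + 1) ^ q * t ^ q := by
  obtain ⟨hc1, hc2⟩ := abs_le.1 hc
  have h0 : 0 ≤ 1 + 2 * c + t ^ 2 := by nlinarith [sq_nonneg (1 - t)]
  -- For small `t`, use `1 + s ≤ exp s` and `exp y ≤ 1 + y + y²`. For `1 ≤ 2qt`, the base is at most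
  -- `(1 + t)² ≤ ((2q + 1)t)²`, so the last term suffices; the others sum to something nonnegative.
  rcases le_total (2 * q * t) 1 with h | h
  · have ht4 : t ≤ 1 / 4 := by nlinarith
    have hs : |2 * c + t ^ 2| ≤ 9 / 4 * t := by
      rw [abs_le]; constructor <;> nlinarith
    set y := q / 2 * (2 * c + t ^ 2) with hy
    have hyabs : |y| ≤ 9 / 8 * (q * t) := by
      rw [hy, abs_mul, abs_of_nonneg (by positivity)]
      nlinarith
    have hy2 : y ^ 2 ≤ (9 / 8 * (q * t)) ^ 2 := sq_le_sq' (by linarith [(abs_le.1 hyabs).1])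
      (abs_le.1 hyabs).2
    have hexp := (abs_le.1 (Real.abs_exp_sub_one_sub_id_le (x := y) (by nlinarith))).2
    have hle : (1 + 2 * c + t ^ 2) ^ (q / 2) ≤ Real.exp y := by
      calc (1 + 2 * c + t ^ 2) ^ (q / 2) ≤ Real.exp (2 * c + t ^ 2) ^ (q / 2) := by
            gcongr
            linarith [Real.add_one_le_exp (2 * c + t ^ 2)]
        _ = Real.exp y := by rw [← Real.exp_mul, hy, mul_comm]
    have hpos : 0 ≤ (2 * q + 1) ^ q * t ^ q := by positivity
    have hqt : q / 2 * t ^ 2 ≤ q ^ 2 / 4 * t ^ 2 := by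
      exact mul_le_mul_of_nonneg_right (by nlinarith) (sq_nonneg t)
    have hyeq : y = q * c + q / 2 * t ^ 2 := by rw [hy]; ring
    nlinarith [sq_nonneg (q * t)]
  · have hle : (1 + 2 * c + t ^ 2) ^ (q / 2) ≤ (2 * q + 1) ^ q * t ^ q := by
      calc (1 + 2 * c + t ^ 2) ^ (q / 2) ≤ (((2 * q + 1) * t) ^ (2 : ℝ)) ^ (q / 2) := by
            gcongr
            rw [Real.rpow_two]
            nlinarith
        _ = ((2 * q + 1) * t) ^ q := by
            rw [← Real.rpow_mul (by positivity)]; congr 1; ring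
        _ = _ := Real.mul_rpow (by positivity) ht
    nlinarith [mul_nonneg (by positivity : 0 ≤ q * t) (sub_nonneg.2 h)]

/-- A second-order Taylor bound for the `q`-th power of the norm in an inner product space. -/
theorem norm_add_rpow_le {H : Type*} [NormedAddCommGroup H] [InnerProductSpace ℝ H] {q : ℝ}
    (hq : 2 ≤ q) (x v : H) :
    ‖x + v‖ ^ q ≤ ‖x‖ ^ q + q * (‖x‖ ^ (q - 2) * ⟪x, v⟫) +
      2 * q ^ 2 * (‖x‖ ^ (q - 2) * ‖v‖ ^ 2) + (2 * q + 1) ^ q * ‖v‖ ^ q := by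
  rcases eq_or_ne x 0 with rfl | hx
  · have h1 : 1 ≤ (2 * q + 1) ^ q := Real.one_le_rpow (by linarith) (by linarith)
    have h2 : 0 ≤ ‖v‖ ^ q := by positivity
    have h3 : 0 ≤ 2 * q ^ 2 * (‖(0 : H)‖ ^ (q - 2) * ‖v‖ ^ 2) := by positivity
    have h4 : 0 ≤ ‖(0 : H)‖ ^ q := by positivity
    simp only [zero_add, inner_zero_left, mul_zero, add_zero]
    nlinarith
  · have hn : 0 < ‖x‖ := norm_pos_iff.2 hx
    have key := one_add_two_mul_add_sq_rpow_le hq (c := ⟪x, v⟫ / ‖x‖ ^ 2) (t := ‖v‖ / ‖x‖)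
      (by positivity) (by
        rw [abs_div, abs_of_nonneg (by positivity : 0 ≤ ‖x‖ ^ 2), div_le_div_iff₀ (by positivity) hn]
        nlinarith [abs_real_inner_le_norm x v])
    have hsq : ‖x + v‖ ^ 2 = ‖x‖ ^ 2 * (1 + 2 * (⟪x, v⟫ / ‖x‖ ^ 2) + (‖v‖ / ‖x‖) ^ 2) := by
      rw [norm_add_sq_real]; field_simp
    have hpow : ∀ y : ℝ, 0 ≤ y → (y ^ 2) ^ (q / 2) = y ^ q := fun y hy => by
      rw [← Real.rpow_two, ← Real.rpow_mul hy]; congr 1; ring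
    have hb : 0 ≤ 1 + 2 * (⟪x, v⟫ / ‖x‖ ^ 2) + (‖v‖ / ‖x‖) ^ 2 := by
      have := sq_nonneg ‖x + v‖
      rw [hsq] at this
      exact nonneg_of_mul_nonneg_right this (by positivity)
    rw [← hpow _ (norm_nonneg (x + v)), hsq, Real.mul_rpow (by positivity) hb,
      hpow _ (norm_nonneg x)]
    refine (mul_le_mul_of_nonneg_left key (by positivity)).trans (le_of_eq ?_)
    rw [Real.rpow_sub hn, Real.rpow_two, Real.div_rpow (norm_nonneg v) hn.le]
    have : ‖x‖ ^ q ≠ 0 := by positivity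
    field_simp

/-- Bernoulli's inequality with exponent `q / 2 ≥ 1`, scaled by `x ^ q`. At `x = 0` the case `q = 2`
stands apart because `0 ^ 0 = 1`. -/
theorem rpow_add_mul_le_sq_add_sq_rpow {q x y : ℝ} (hq : 2 ≤ q) (hx : 0 ≤ x) :
    x ^ q + q / 2 * (x ^ (q - 2) * y ^ 2) ≤ (x ^ 2 + y ^ 2) ^ (q / 2) := by
  rcases hx.eq_or_lt with rfl | hx
  · rcases hq.eq_or_lt with rfl | hq
    · norm_num
    · rw [Real.zero_rpow (by linarith), Real.zero_rpow (by linarith)]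
      simp only [zero_mul, mul_zero, add_zero]
      positivity
  · have hb := one_add_mul_self_le_rpow_one_add (s := (y / x) ^ 2) (p := q / 2)
      (by linarith [sq_nonneg (y / x)]) (by linarith)
    have hpow : (x ^ 2) ^ (q / 2) = x ^ q := by
      rw [← Real.rpow_two, ← Real.rpow_mul hx.le]; congr 1; ring
    have heq : x ^ 2 + y ^ 2 = x ^ 2 * (1 + (y / x) ^ 2) := by field_simp
    rw [heq, Real.mul_rpow (by positivity) (by positivity), hpow]
    refine le_trans (le_of_eq ?_) (mul_le_mul_of_nonneg_left hb (by positivity))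
    rw [Real.rpow_sub hx, Real.rpow_two]
    field_simp

/-- Squaring reduces `2q + 1 ≤ 2q^(3/2)` to a cubic inequality valid for `q ≥ 2`. The moment
estimates use `ρ` only through this consequence. -/
theorem two_mul_add_one_mul_le_one {q ρ : ℝ} (hq : 2 ≤ q)
    (hρ : |ρ| ≤ 1 / (2 * q ^ (3 / 2 : ℝ))) : (2 * q + 1) * |ρ| ≤ 1 := by
  have hs : (q ^ (3 / 2 : ℝ)) ^ 2 = q ^ 3 := by
    rw [← Real.rpow_two, ← Real.rpow_mul (by linarith), ← Real.rpow_natCast]; norm_num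
  have hle : 2 * q + 1 ≤ 2 * q ^ (3 / 2 : ℝ) := by
    refine abs_le_of_sq_le_sq' ?_ (by positivity) |>.2
    rw [mul_pow, hs]
    nlinarith [mul_nonneg (sub_nonneg.2 hq) (sq_nonneg q), mul_nonneg (sub_nonneg.2 hq) (sub_nonneg.2 hq)]
  have hpos : 0 < q ^ (3 / 2 : ℝ) := by positivity
  rw [le_div_iff₀ (by positivity)] at hρ
  nlinarith [abs_nonneg ρ]

theorem rpow_sub_two_mul_le {q x y : ℝ} (hq : 2 ≤ q) (hx : 0 ≤ x) (hy : 0 ≤ y) :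
    x ^ (q - 2) * y ^ 2 ≤ (x + y) ^ q := by
  calc x ^ (q - 2) * y ^ 2 ≤ (x + y) ^ (q - 2) * (x + y) ^ (2 : ℝ) := by
        rw [Real.rpow_two]; gcongr <;> linarith
    _ = (x + y) ^ q := by
        rw [← Real.rpow_add' (by positivity) (by linarith)]; congr 1; ring

theorem integrable_norm_rpow_of_memLp {Ω E : Type*} [MeasurableSpace Ω] {μ : Measure Ω}
    [NormedAddCommGroup E] {q : ℝ} (hq : 0 < q) {X : Ω → E}
    (hX : MemLp X (ENNReal.ofReal q) μ) : Integrable (fun ω => ‖X ω‖ ^ q) μ := by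
  have := hX.integrable_norm_rpow (by simpa using hq) ENNReal.ofReal_ne_top
  rwa [ENNReal.toReal_ofReal hq.le] at this

/-! ### Splitting off one variable -/

section OneStep

variable {Ω : Type*} [MeasurableSpace Ω] {μ : Measure Ω} [IsProbabilityMeasure μ]
  {H : Type*} [NormedAddCommGroup H] [InnerProductSpace ℝ H]

/-- If `Z` is centred of variance one and independent of `(X, Y)`, then the `q`-th moment of
`X + ρ Z Y` is at most that of `(X, Y)` plus the `q`-th moment of `Z` times that of `Y`. -/
theorem integral_norm_add_smul_rpow_le {q ρ M : ℝ} (hq : 2 ≤ q)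
    (hρ : (2 * q + 1) * |ρ| ≤ 1) {Z : Ω → ℝ} {X Y : Ω → H}
    (hZq : MemLp Z (ENNReal.ofReal q) μ)
    (hmean : ∫ ω, Z ω ∂μ = 0) (hvar : ∫ ω, Z ω ^ 2 ∂μ = 1) (hM : ∫ ω, |Z ω| ^ q ∂μ ≤ M)
    (hX : MemLp X (ENNReal.ofReal q) μ) (hY : MemLp Y (ENNReal.ofReal q) μ)
    (hind : IndepFun Z (fun ω => (‖X ω‖, ‖Y ω‖, (⟪X ω, Y ω⟫ : ℝ))) μ) :
    ∫ ω, ‖X ω + (ρ * Z ω) • Y ω‖ ^ q ∂μ ≤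
      ∫ ω, (‖X ω‖ ^ 2 + ‖Y ω‖ ^ 2) ^ (q / 2) ∂μ + M * ∫ ω, ‖Y ω‖ ^ q ∂μ := by
  have hq0 : 0 < q := by linarith
  have hiX := integrable_norm_rpow_of_memLp hq0 hX
  have hiY := integrable_norm_rpow_of_memLp hq0 hY
  have hiZ : Integrable (fun ω => |Z ω| ^ q) μ := integrable_norm_rpow_of_memLp hq0 hZq
  have hone : (1 : ℝ≥0∞) ≤ ENNReal.ofReal q := by
    rw [← ENNReal.ofReal_one]; exact ENNReal.ofReal_le_ofReal (by linarith)
  have htwo : (2 : ℝ≥0∞) ≤ ENNReal.ofReal q := by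
    rw [← ENNReal.ofReal_ofNat]; exact ENNReal.ofReal_le_ofReal hq
  have hiZ1 : Integrable Z μ := hZq.integrable hone
  have hiZ2 : Integrable (fun ω => Z ω ^ 2) μ := (hZq.mono_exponent htwo).integrable_sq
  have hiXY : Integrable (fun ω => (‖X ω‖ + ‖Y ω‖) ^ q) μ := by
    have := integrable_norm_rpow_of_memLp hq0 (hX.norm.add hY.norm)
    refine this.congr (ae_of_all _ fun ω => ?_)
    simp only [Pi.add_apply, Real.norm_eq_abs]
    rw [abs_of_nonneg (by positivity)]
  have mX := hX.aestronglyMeasurable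
  have mY := hY.aestronglyMeasurable
  have mXq : AEStronglyMeasurable (fun ω => ‖X ω‖ ^ (q - 2)) μ :=
    (Real.continuous_rpow_const (by linarith)).comp_aestronglyMeasurable mX.norm
  have hiA : Integrable (fun ω => ‖X ω‖ ^ (q - 2) * ⟪X ω, Y ω⟫) μ := by
    refine hiXY.mono' (mXq.mul (mX.inner mY)) (ae_of_all _ fun ω => ?_)
    rw [norm_mul, Real.norm_of_nonneg (by positivity), Real.norm_eq_abs]
    calc ‖X ω‖ ^ (q - 2) * |⟪X ω, Y ω⟫|
        ≤ (‖X ω‖ + ‖Y ω‖) ^ (q - 2) * (‖X ω‖ + ‖Y ω‖) ^ (2 : ℝ) := by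
          have := abs_real_inner_le_norm (X ω) (Y ω)
          rw [Real.rpow_two]
          gcongr
          · linarith [norm_nonneg (Y ω)]
          · nlinarith [norm_nonneg (X ω), norm_nonneg (Y ω)]
      _ = _ := by
          rw [← Real.rpow_add' (by positivity) (by linarith)]; congr 1; ring
  have hiB : Integrable (fun ω => ‖X ω‖ ^ (q - 2) * ‖Y ω‖ ^ 2) μ := by
    refine hiXY.mono' (mXq.mul (mY.norm.pow 2)) (ae_of_all _ fun ω => ?_)
    rw [Real.norm_of_nonneg (by positivity)]
    exact rpow_sub_two_mul_le hq (norm_nonneg _) (norm_nonneg _)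
  have indA : IndepFun Z (fun ω => ‖X ω‖ ^ (q - 2) * ⟪X ω, Y ω⟫) μ :=
    hind.comp (φ := id) (ψ := fun p : ℝ × ℝ × ℝ => p.1 ^ (q - 2) * p.2.2) measurable_id
      (by fun_prop)
  have indB : IndepFun (fun ω => Z ω ^ 2) (fun ω => ‖X ω‖ ^ (q - 2) * ‖Y ω‖ ^ 2) μ :=
    hind.comp (φ := fun z => z ^ 2) (ψ := fun p : ℝ × ℝ × ℝ => p.1 ^ (q - 2) * p.2.1 ^ 2)
      (by fun_prop) (by fun_prop)
  have indC : IndepFun (fun ω => |Z ω| ^ q) (fun ω => ‖Y ω‖ ^ q) μ :=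
    hind.comp (φ := fun z => |z| ^ q) (ψ := fun p : ℝ × ℝ × ℝ => p.2.1 ^ q)
      (by fun_prop) (by fun_prop)
  have iA : Integrable (fun ω => Z ω * (‖X ω‖ ^ (q - 2) * ⟪X ω, Y ω⟫)) μ :=
    indA.integrable_mul hiZ1 hiA
  have iB : Integrable (fun ω => Z ω ^ 2 * (‖X ω‖ ^ (q - 2) * ‖Y ω‖ ^ 2)) μ :=
    indB.integrable_mul hiZ2 hiB
  have iC : Integrable (fun ω => |Z ω| ^ q * ‖Y ω‖ ^ q) μ :=
    indC.integrable_mul hiZ hiY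
  have eA := indA.integral_fun_mul_eq_mul_integral hiZ1.aestronglyMeasurable
    hiA.aestronglyMeasurable
  have eB := indB.integral_fun_mul_eq_mul_integral hiZ2.aestronglyMeasurable
    hiB.aestronglyMeasurable
  have eC := indC.integral_fun_mul_eq_mul_integral hiZ.aestronglyMeasurable
    hiY.aestronglyMeasurable
  rw [hmean, zero_mul] at eA
  rw [hvar, one_mul] at eB
  have hρ0 := abs_nonneg ρ
  -- The target `q / 2` is the coefficient that Bernoulli's inequality can absorb.
  have hρ2 : 2 * q ^ 2 * ρ ^ 2 ≤ q / 2 := by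
    rw [← sq_abs ρ]
    have h1 : 2 * (q * |ρ|) ≤ 1 := by nlinarith
    nlinarith [mul_nonneg (by linarith : 0 ≤ q) hρ0]
  have hρq : (2 * q + 1) ^ q * |ρ| ^ q ≤ 1 := by
    rw [← Real.mul_rpow (by linarith) hρ0]
    exact Real.rpow_le_one (by positivity) hρ (by linarith)
  have hpt : ∀ ω, ‖X ω + (ρ * Z ω) • Y ω‖ ^ q ≤
      ‖X ω‖ ^ q + q * ρ * (Z ω * (‖X ω‖ ^ (q - 2) * ⟪X ω, Y ω⟫)) +
      q / 2 * (Z ω ^ 2 * (‖X ω‖ ^ (q - 2) * ‖Y ω‖ ^ 2)) + |Z ω| ^ q * ‖Y ω‖ ^ q := fun ω => by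
    refine (norm_add_rpow_le hq _ _).trans ?_
    rw [inner_smul_right, norm_smul, norm_mul, Real.norm_eq_abs, Real.norm_eq_abs,
      Real.mul_rpow (by positivity) (by positivity), Real.mul_rpow (by positivity) (by positivity),
      mul_pow, mul_pow, sq_abs, sq_abs]
    have t1 : 0 ≤ Z ω ^ 2 * (‖X ω‖ ^ (q - 2) * ‖Y ω‖ ^ 2) := by positivity
    have t2 : 0 ≤ |Z ω| ^ q * ‖Y ω‖ ^ q := by positivity
    nlinarith [mul_le_mul_of_nonneg_right hρ2 t1, mul_le_mul_of_nonneg_right hρq t2]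
  have hintR : Integrable (fun ω => ‖X ω‖ ^ q + q * ρ * (Z ω * (‖X ω‖ ^ (q - 2) * ⟪X ω, Y ω⟫)) +
      q / 2 * (Z ω ^ 2 * (‖X ω‖ ^ (q - 2) * ‖Y ω‖ ^ 2)) + |Z ω| ^ q * ‖Y ω‖ ^ q) μ :=
    ((hiX.add (iA.const_mul (q * ρ))).add (iB.const_mul (q / 2))).add iC
  have hsum : Integrable (fun ω => (‖X ω‖ ^ 2 + ‖Y ω‖ ^ 2) ^ (q / 2)) μ := by
    refine hiXY.mono' ((Real.continuous_rpow_const (by linarith)).comp_aestronglyMeasurable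
      ((mX.norm.pow 2).add (mY.norm.pow 2))) (ae_of_all _ fun ω => ?_)
    rw [Real.norm_of_nonneg (by positivity)]
    calc (‖X ω‖ ^ 2 + ‖Y ω‖ ^ 2) ^ (q / 2) ≤ ((‖X ω‖ + ‖Y ω‖) ^ (2 : ℝ)) ^ (q / 2) := by
          rw [Real.rpow_two]; gcongr
          nlinarith [norm_nonneg (X ω), norm_nonneg (Y ω)]
      _ = _ := by rw [← Real.rpow_mul (by positivity)]; congr 1; ring
  calc ∫ ω, ‖X ω + (ρ * Z ω) • Y ω‖ ^ q ∂μ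
      ≤ ∫ ω, (‖X ω‖ ^ q + q * ρ * (Z ω * (‖X ω‖ ^ (q - 2) * ⟪X ω, Y ω⟫)) +
        q / 2 * (Z ω ^ 2 * (‖X ω‖ ^ (q - 2) * ‖Y ω‖ ^ 2)) + |Z ω| ^ q * ‖Y ω‖ ^ q) ∂μ :=
        integral_mono_of_nonneg (ae_of_all _ fun ω => by positivity) hintR (ae_of_all _ hpt)
    _ = ∫ ω, ‖X ω‖ ^ q ∂μ + q / 2 * ∫ ω, ‖X ω‖ ^ (q - 2) * ‖Y ω‖ ^ 2 ∂μ +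
        (∫ ω, |Z ω| ^ q ∂μ) * ∫ ω, ‖Y ω‖ ^ q ∂μ := by
        rw [integral_add (by exact (hiX.add (iA.const_mul (q * ρ))).add (iB.const_mul (q / 2))) iC,
          integral_add (by exact hiX.add (iA.const_mul (q * ρ))) (iB.const_mul (q / 2)),
          integral_add hiX (iA.const_mul (q * ρ)), integral_const_mul, integral_const_mul,
          eA, eB, eC]
        ring
    _ = ∫ ω, (‖X ω‖ ^ q + q / 2 * (‖X ω‖ ^ (q - 2) * ‖Y ω‖ ^ 2)) ∂μ +
        (∫ ω, |Z ω| ^ q ∂μ) * ∫ ω, ‖Y ω‖ ^ q ∂μ := by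
        rw [integral_add hiX (hiB.const_mul _), integral_const_mul]
    _ ≤ _ := by
        refine add_le_add (integral_mono (hiX.add (hiB.const_mul _)) hsum fun ω =>
          rpow_add_mul_le_sq_add_sq_rpow hq (norm_nonneg _)) ?_
        exact mul_le_mul_of_nonneg_right hM (integral_nonneg fun ω => by positivity)

end OneStep

/-! ### Induction over independent variables, and Parseval -/

section Independent

variable {Ω : Type*} [MeasurableSpace Ω] {μ : Measure Ω}
  {ι : Type*} [DecidableEq ι] {Z : ι → Ω → ℝ}

/-- Only three real-valued functions of the two sums enter the one-variable step, so `H` needs no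
measurable structure. -/
theorem indepFun_sum_prod_smul {H : Type*} [NormedAddCommGroup H] [InnerProductSpace ℝ H]
    (hmeas : ∀ i, Measurable (Z i)) (hindep : iIndepFun Z μ) {s : Finset ι} {i : ι} (hi : i ∉ s)
    (c : Finset ι → ℝ) (a b : Finset ι → H) :
    IndepFun (Z i) (fun ω =>
      (‖∑ S ∈ s.powerset, (c S * ∏ j ∈ S, Z j ω) • a S‖,
       ‖∑ S ∈ s.powerset, (c S * ∏ j ∈ S, Z j ω) • b S‖,
       (⟪∑ S ∈ s.powerset, (c S * ∏ j ∈ S, Z j ω) • a S,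
         ∑ S ∈ s.powerset, (c S * ∏ j ∈ S, Z j ω) • b S⟫ : ℝ))) μ := by
  have h := hindep.indepFun_finset {i} s (by simpa using hi) hmeas
  -- The default `0` is never read, since only indices in subsets of `s` occur.
  let w : (s → ℝ) → ι → ℝ := fun v j => if hj : j ∈ s then v ⟨j, hj⟩ else 0
  have hw : ∀ j, Continuous fun v => w v j := fun j => by
    by_cases hj : j ∈ s
    · simpa [w, hj] using continuous_apply _
    · simpa [w, hj] using continuous_const
  let X : (Finset ι → H) → (s → ℝ) → H := fun a v =>
    ∑ S ∈ s.powerset, (c S * ∏ j ∈ S, w v j) • a S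
  have hX : ∀ a, Continuous (X a) := fun a =>
    continuous_finsetSum _ fun S _ =>
      (continuous_const.mul (continuous_finsetProd _ fun j _ => hw j)).smul continuous_const
  have hXe : ∀ a ω, X a (fun j : s => Z j ω) =
      ∑ S ∈ s.powerset, (c S * ∏ j ∈ S, Z j ω) • a S := fun a ω => by
    refine Finset.sum_congr rfl fun S hS => ?_
    congr 2
    exact Finset.prod_congr rfl fun j hj => by simp [w, Finset.mem_powerset.1 hS hj]
  have hφ : Measurable fun v : ({i} : Finset ι) → ℝ => v ⟨i, Finset.mem_singleton_self i⟩ :=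
    measurable_pi_apply _
  have hc := h.comp
    (ψ := fun v => (‖X a v‖, ‖X b v‖, (⟪X a v, X b v⟫ : ℝ))) hφ
    ((hX a).norm.prodMk ((hX b).norm.prodMk ((hX a).inner (hX b)))).measurable
  have e : (fun v => (‖X a v‖, ‖X b v‖, (⟪X a v, X b v⟫ : ℝ))) ∘ (fun ω (j : s) => Z j ω) =
      fun ω => (‖∑ S ∈ s.powerset, (c S * ∏ j ∈ S, Z j ω) • a S‖,
       ‖∑ S ∈ s.powerset, (c S * ∏ j ∈ S, Z j ω) • b S‖,
       (⟪∑ S ∈ s.powerset, (c S * ∏ j ∈ S, Z j ω) • a S,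
         ∑ S ∈ s.powerset, (c S * ∏ j ∈ S, Z j ω) • b S⟫ : ℝ)) := by
    funext ω
    simp only [Function.comp_apply, hXe]
  rw [e] at hc
  exact hc

variable [IsProbabilityMeasure μ]

/-- By independence `q`-th moments multiply, so no exponent is lost as it would be with Hölder. -/
theorem memLp_prod_of_iIndepFun {q : ℝ} (hq : 0 < q) (hmeas : ∀ i, Measurable (Z i))
    (hindep : iIndepFun Z μ) (hLq : ∀ i, MemLp (Z i) (ENNReal.ofReal q) μ) (S : Finset ι) :
    MemLp (fun ω => ∏ i ∈ S, Z i ω) (ENNReal.ofReal q) μ := by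
  induction S using Finset.induction_on with
  | empty => simpa using memLp_const (1 : ℝ)
  | insert i s hi ih =>
    have hm : Measurable (fun ω => ∏ j ∈ insert i s, Z j ω) :=
      Finset.measurable_fun_prod _ fun j _ => hmeas j
    rw [← integrable_norm_rpow_iff hm.aestronglyMeasurable (by simpa using hq)
      ENNReal.ofReal_ne_top, ENNReal.toReal_ofReal hq.le]
    have hind : IndepFun (fun ω => ‖Z i ω‖ ^ q) (fun ω => ‖∏ j ∈ s, Z j ω‖ ^ q) μ := by
      have h := (hindep.indepFun_finsetProd_of_notMem hmeas hi).symm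
      have h2 := h.comp (φ := fun z : ℝ => ‖z‖ ^ q) (ψ := fun z : ℝ => ‖z‖ ^ q)
        (by fun_prop) (by fun_prop)
      convert h2 using 2 with ω
      · rfl
      · rw [Function.comp_apply, Finset.prod_apply]
    have := hind.integrable_mul (integrable_norm_rpow_of_memLp hq (hLq i))
      (integrable_norm_rpow_of_memLp hq ih)
    refine this.congr (ae_of_all _ fun ω => ?_)
    simp only [Pi.mul_apply, Finset.prod_insert hi, norm_mul]
    rw [Real.mul_rpow (norm_nonneg _) (norm_nonneg _)]

theorem memLp_sum_prod_smul {H : Type*} [NormedAddCommGroup H] [NormedSpace ℝ H]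
    {q : ℝ} (hq : 0 < q) (hmeas : ∀ i, Measurable (Z i))
    (hindep : iIndepFun Z μ) (hLq : ∀ i, MemLp (Z i) (ENNReal.ofReal q) μ)
    {κ : Type*} (A : Finset κ) (S : κ → Finset ι) (c : κ → ℝ) (a : κ → H) :
    MemLp (fun ω => ∑ k ∈ A, (c k * ∏ i ∈ S k, Z i ω) • a k) (ENNReal.ofReal q) μ := by
  refine memLp_finsetSum _ fun k _ => ?_
  have h := (memLp_prod_of_iIndepFun hq hmeas hindep hLq (S k)).const_mul (c k)
  refine MemLp.of_le_mul (c := ‖a k‖) h (h.aestronglyMeasurable.smul_const (a k))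
    (ae_of_all _ fun ω => ?_)
  rw [norm_smul, mul_comm]

/-- Hypercontractivity for multilinear polynomials with coefficients in an inner product space.
In the inductive step the coefficients move to the Hilbert sum `H × H`. -/
theorem integral_norm_noise_rpow_le {q ρ : ℝ} (hq : 2 ≤ q) (hρ : (2 * q + 1) * |ρ| ≤ 1)
    (hmeas : ∀ i, Measurable (Z i)) (hindep : iIndepFun Z μ)
    (hLq : ∀ i, MemLp (Z i) (ENNReal.ofReal q) μ) (hmean : ∀ i, ∫ ω, Z i ω ∂μ = 0)
    (hvar : ∀ i, ∫ ω, Z i ω ^ 2 ∂μ = 1) {M : ι → ℝ} (hM : ∀ i, ∫ ω, |Z i ω| ^ q ∂μ ≤ M i)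
    (s : Finset ι) {H : Type*} [NormedAddCommGroup H] [InnerProductSpace ℝ H]
    (a : Finset ι → H) :
    ∫ ω, ‖∑ S ∈ s.powerset, (ρ ^ S.card * ∏ i ∈ S, Z i ω) • a S‖ ^ q ∂μ ≤
      ∑ S ∈ s.powerset, (∏ i ∈ S, M i) * (∑ R ∈ s.powerset with S ⊆ R, ‖a R‖ ^ 2) ^ (q / 2) := by
  have hq0 : 0 < q := by linarith
  have hM0 : ∀ i, 0 ≤ M i := fun i =>
    (integral_nonneg fun ω => by positivity).trans (hM i)
  have hsq : ∀ y : ℝ, 0 ≤ y → (y ^ 2) ^ (q / 2) = y ^ q := fun y hy => by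
    rw [← Real.rpow_two, ← Real.rpow_mul hy]; congr 1; ring
  induction s using Finset.induction_on generalizing H with
  | empty => simp [hsq, Finset.filter_singleton]
  | insert i s hi ih =>
    have hiS : ∀ S ∈ s.powerset, i ∉ S := fun S hS h => hi (Finset.mem_powerset.1 hS h)
    set X : Ω → H := fun ω => ∑ S ∈ s.powerset, (ρ ^ S.card * ∏ j ∈ S, Z j ω) • a S with hX
    set Y : Ω → H := fun ω => ∑ S ∈ s.powerset, (ρ ^ S.card * ∏ j ∈ S, Z j ω) • a (insert i S)
      with hY
    have hsplit : ∀ ω, ∑ S ∈ (insert i s).powerset, (ρ ^ S.card * ∏ j ∈ S, Z j ω) • a S =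
        X ω + (ρ * Z i ω) • Y ω := fun ω => by
      rw [Finset.sum_powerset_insert hi, hX, hY, Finset.smul_sum]
      congr 1
      refine Finset.sum_congr rfl fun S hS => ?_
      rw [Finset.card_insert_of_notMem (hiS S hS), Finset.prod_insert (hiS S hS), smul_smul]
      congr 1
      ring
    simp only [hsplit]
    have hXm : MemLp X (ENNReal.ofReal q) μ :=
      memLp_sum_prod_smul hq0 hmeas hindep hLq s.powerset id (fun S => ρ ^ S.card) a
    have hYm : MemLp Y (ENNReal.ofReal q) μ :=
      memLp_sum_prod_smul hq0 hmeas hindep hLq s.powerset id (fun S => ρ ^ S.card)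
        (fun S => a (insert i S))
    refine (integral_norm_add_smul_rpow_le hq hρ (hLq i) (hmean i) (hvar i) (hM i) hXm hYm
      (indepFun_sum_prod_smul hmeas hindep hi (fun S => ρ ^ S.card) a
        (fun S => a (insert i S)))).trans ?_
    let b : Finset ι → WithLp 2 (H × H) := fun S => WithLp.toLp 2 (a S, a (insert i S))
    have hb : ∀ S, ‖b S‖ ^ 2 = ‖a S‖ ^ 2 + ‖a (insert i S)‖ ^ 2 := fun S =>
      WithLp.prod_norm_sq_eq_of_L2 _
    have hXY : ∀ ω, (‖X ω‖ ^ 2 + ‖Y ω‖ ^ 2) ^ (q / 2) =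
        ‖∑ S ∈ s.powerset, (ρ ^ S.card * ∏ j ∈ S, Z j ω) • b S‖ ^ q := fun ω => by
      rw [← hsq _ (norm_nonneg _), WithLp.prod_norm_sq_eq_of_L2]
      have hfst : ∀ u : WithLp 2 (H × H), u.fst = u.ofLp.1 := fun _ => rfl
      have hsnd : ∀ u : WithLp 2 (H × H), u.snd = u.ofLp.2 := fun _ => rfl
      simp [hX, hY, b, hfst, hsnd, WithLp.ofLp_sum, Prod.fst_sum, Prod.snd_sum]
    simp only [hXY]
    -- The paired coefficients `b` produce the terms with `i ∉ S`; the derivative coefficients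
    -- produce those with `i ∈ S`, with the extra factor `M i`.
    have h1 := ih b
    have h2 := ih (fun S => a (insert i S))
    rw [Finset.sum_powerset_insert hi]
    refine add_le_add (h1.trans (le_of_eq ?_))
      ((mul_le_mul_of_nonneg_left h2 (hM0 i)).trans (le_of_eq ?_))
    · refine Finset.sum_congr rfl fun S hS => ?_
      congr 2
      simp only [Finset.sum_filter]
      rw [Finset.sum_powerset_insert hi, ← Finset.sum_add_distrib]
      refine Finset.sum_congr rfl fun R _ => ?_
      simp only [Finset.subset_insert_iff_of_notMem (hiS S hS)]
      split_ifs <;> simp [hb]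
    · rw [Finset.mul_sum]
      refine Finset.sum_congr rfl fun S hS => ?_
      rw [Finset.prod_insert (hiS S hS), ← mul_assoc]
      congr 2
      simp only [Finset.sum_filter]
      rw [Finset.sum_powerset_insert hi, Finset.sum_eq_zero (s := s.powerset)
        (f := fun R => if insert i S ⊆ R then ‖a R‖ ^ 2 else 0), zero_add]
      · refine Finset.sum_congr rfl fun R hR => ?_
        simp only [Finset.insert_subset_insert_iff (hiS S hS)]
      · intro R hR
        rw [if_neg fun h => hiS R hR (h (Finset.mem_insert_self i S))]

theorem integral_prod_mul_prod [Fintype ι] (hmeas : ∀ i, Measurable (Z i))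
    (hindep : iIndepFun Z μ) (hmean : ∀ i, ∫ ω, Z i ω ∂μ = 0)
    (hvar : ∀ i, ∫ ω, Z i ω ^ 2 ∂μ = 1) (S T : Finset ι) :
    ∫ ω, (∏ i ∈ S, Z i ω) * ∏ i ∈ T, Z i ω ∂μ = if S = T then 1 else 0 := by
  -- Each factor is `z²`, `z` or `1`; if `S ≠ T`, some index gives `z`, whose mean is zero.
  let g : ι → ℝ → ℝ := fun i z => (if i ∈ S then z else 1) * (if i ∈ T then z else 1)
  have hg : ∀ i, Measurable (g i) := fun i => by
    dsimp only [g]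
    split_ifs <;> fun_prop
  have hprod : ∀ ω, (∏ i ∈ S, Z i ω) * ∏ i ∈ T, Z i ω = ∏ i, g i (Z i ω) := fun ω => by
    simp only [g, Finset.prod_mul_distrib, Finset.prod_ite_mem, Finset.univ_inter]
  simp only [hprod]
  rw [hindep.integral_fun_prod_comp (fun i => (hmeas i).aemeasurable)
    (fun i => (hg i).aestronglyMeasurable)]
  split_ifs with h
  · subst h
    refine Finset.prod_eq_one fun i _ => ?_
    by_cases hi : i ∈ S
    · simpa [g, hi, ← sq] using hvar i
    · simp [g, hi]
  · obtain ⟨i, hi⟩ := not_forall.1 (fun h' => h (Finset.ext h'))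
    refine Finset.prod_eq_zero (Finset.mem_univ i) ?_
    by_cases hS : i ∈ S <;> by_cases hT : i ∈ T <;> simp_all [g]

/-- The Parseval identity for the orthonormal products `∏ i ∈ S, Z i`. -/
theorem integral_sum_prod_sq [Fintype ι] (hmeas : ∀ i, Measurable (Z i))
    (hindep : iIndepFun Z μ) (hL2 : ∀ i, MemLp (Z i) 2 μ) (hmean : ∀ i, ∫ ω, Z i ω ∂μ = 0)
    (hvar : ∀ i, ∫ ω, Z i ω ^ 2 ∂μ = 1) {κ : Type*} [DecidableEq κ] {A : Finset κ}
    {S : κ → Finset ι} (hS : Set.InjOn S A) (a : κ → ℝ) :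
    ∫ ω, (∑ k ∈ A, a k * ∏ i ∈ S k, Z i ω) ^ 2 ∂μ = ∑ k ∈ A, a k ^ 2 := by
  have hP : ∀ T : Finset ι, MemLp (fun ω => ∏ i ∈ T, Z i ω) 2 μ := fun T => by
    rw [← ENNReal.ofReal_ofNat] at hL2 ⊢
    exact memLp_prod_of_iIndepFun two_pos hmeas hindep hL2 T
  have hint : ∀ k l, Integrable
      (fun ω => a k * a l * ((∏ i ∈ S k, Z i ω) * ∏ i ∈ S l, Z i ω)) μ :=
    fun k l => ((hP (S k)).integrable_mul (hP (S l))).const_mul _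
  have hexp : ∀ ω, (∑ k ∈ A, a k * ∏ i ∈ S k, Z i ω) ^ 2 =
      ∑ k ∈ A, ∑ l ∈ A, a k * a l * ((∏ i ∈ S k, Z i ω) * ∏ i ∈ S l, Z i ω) := fun ω => by
    rw [sq, Finset.sum_mul_sum]
    exact Finset.sum_congr rfl fun k _ => Finset.sum_congr rfl fun l _ => by ring
  simp only [hexp]
  rw [integral_finsetSum _ fun k _ => integrable_finsetSum _ fun l _ => hint k l]
  refine Finset.sum_congr rfl fun k hk => ?_
  rw [integral_finsetSum _ fun l _ => hint k l, Finset.sum_eq_single k]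
  · rw [integral_const_mul, integral_prod_mul_prod hmeas hindep hmean hvar, if_pos rfl]; ring
  · intro l hl hlk
    rw [integral_const_mul, integral_prod_mul_prod hmeas hindep hmean hvar,
      if_neg fun h => hlk (hS hl hk h.symm), mul_zero]
  · exact fun h => absurd hk h

end Independent

/-! ### Norm conversions and the spare factor `√2` -/

theorem eLpNorm_ofReal_rpow {Ω : Type*} [MeasurableSpace Ω] {μ : Measure Ω} {q : ℝ} (hq : 0 < q)
    {f : Ω → ℝ} (hf : MemLp f (ENNReal.ofReal q) μ) :
    eLpNorm f (ENNReal.ofReal q) μ ^ q = ENNReal.ofReal (∫ ω, ‖f ω‖ ^ q ∂μ) := by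
  rw [hf.eLpNorm_eq_integral_rpow_norm (by simpa using hq) ENNReal.ofReal_ne_top,
    ENNReal.toReal_ofReal hq.le]
  have h0 : 0 ≤ ∫ ω, ‖f ω‖ ^ q ∂μ := integral_nonneg fun ω => by positivity
  rw [ENNReal.ofReal_rpow_of_nonneg (by positivity) hq.le, ← Real.rpow_mul h0,
    inv_mul_cancel₀ hq.ne', Real.rpow_one]

theorem eLpNorm_two_sq {Ω : Type*} [MeasurableSpace Ω] {μ : Measure Ω}
    {f : Ω → ℝ} (hf : MemLp f 2 μ) :
    eLpNorm f 2 μ ^ 2 = ENNReal.ofReal (∫ ω, f ω ^ 2 ∂μ) := by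
  rw [← ENNReal.ofReal_ofNat] at hf ⊢
  have := eLpNorm_ofReal_rpow two_pos hf
  rw [ENNReal.rpow_two] at this
  rw [this]
  simp

theorem rpow_eq_ofReal_rpow_half {x : ℝ≥0∞} {y q : ℝ} (hq : 0 ≤ q) (hy : 0 ≤ y)
    (h : x ^ 2 = ENNReal.ofReal y) : x ^ q = ENNReal.ofReal (y ^ (q / 2)) := by
  rw [← ENNReal.ofReal_rpow_of_nonneg hy (by positivity), ← h, ← ENNReal.rpow_two,
    ← ENNReal.rpow_mul]
  congr 1; ring

/-- Each `R` is counted once for each of its `2 ^ R.card` subsets, which cancels the damping. -/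
theorem sum_sum_superset_half_pow {ι : Type*} [Fintype ι] [DecidableEq ι] (b : Finset ι → ℝ) :
    ∑ S : Finset ι, ∑ R : Finset ι with S ⊆ R, (1 / 2) ^ R.card * b R = ∑ R, b R := by
  simp only [Finset.sum_filter]
  rw [Finset.sum_comm]
  refine Finset.sum_congr rfl fun R _ => ?_
  rw [← Finset.sum_filter, Finset.sum_const]
  have : (Finset.univ.filter fun S : Finset ι => S ⊆ R) = R.powerset := by ext; simp
  rw [this, Finset.card_powerset, nsmul_eq_mul, ← mul_assoc]
  push_cast
  rw [← mul_pow]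
  norm_num

theorem two_mul_rpow_neg {q : ℝ} (hq : 0 < q) :
    √2 * (2 * q) ^ (-(3 / 2) : ℝ) = 1 / (2 * q ^ (3 / 2 : ℝ)) := by
  have h2 : (2 : ℝ) ^ (3 / 2 : ℝ) = 2 * √2 := by
    rw [Real.sqrt_eq_rpow, show (3 / 2 : ℝ) = 1 + 1 / 2 by norm_num, Real.rpow_add two_pos,
      Real.rpow_one]
  rw [Real.rpow_neg (by positivity), Real.mul_rpow two_pos.le hq.le, h2]
  have : √2 ≠ 0 := by positivity
  field_simp

theorem abs_sqrt_two_mul_le {q ρ : ℝ} (hq : 0 < q) (hρ : |ρ| ≤ (2 * q) ^ (-(3 / 2) : ℝ)) :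
    |√2 * ρ| ≤ 1 / (2 * q ^ (3 / 2 : ℝ)) := by
  rw [abs_mul, abs_of_nonneg (by positivity : 0 ≤ √2), ← two_mul_rpow_neg hq]
  gcongr

theorem abs_le_of_abs_le_two_mul_rpow {q ρ : ℝ} (hq : 0 < q)
    (hρ : |ρ| ≤ (2 * q) ^ (-(3 / 2) : ℝ)) : |ρ| ≤ 1 / (2 * q ^ (3 / 2 : ℝ)) := by
  refine le_trans ?_ (abs_sqrt_two_mul_le hq hρ)
  rw [abs_mul, abs_of_nonneg (by positivity : 0 ≤ √2)]
  exact le_mul_of_one_le_left (abs_nonneg ρ) (Real.one_le_sqrt.2 one_le_two)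

/-- Keeping one factor `w` and bounding the rest of `w ^ (q / 2)` cancels the powers of `s` and
leaves a bound linear in `w`, hence summable over `S`. -/
theorem rpow_two_sub_mul_rpow_half_le {q w B s : ℝ} (hq : 2 ≤ q) (hw : 0 ≤ w) (hs : 0 < s)
    (hB : 0 ≤ B) (h : w ≤ B * s ^ 2) : s ^ (2 - q) * w ^ (q / 2) ≤ B ^ ((q - 2) / 2) * w := by
  have e1 : w ^ (q / 2) = w ^ ((q - 2) / 2) * w := by
    rw [← Real.rpow_add_one' hw (by linarith)]; congr 1; ring
  have e2 : (B * s ^ 2) ^ ((q - 2) / 2) = B ^ ((q - 2) / 2) * s ^ (q - 2) := by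
    rw [Real.mul_rpow hB (by positivity), ← Real.rpow_two, ← Real.rpow_mul hs.le]
    congr 2; ring
  have e3 : s ^ (2 - q) * s ^ (q - 2) = 1 := by
    rw [← Real.rpow_add hs]; simp
  calc s ^ (2 - q) * w ^ (q / 2) ≤ s ^ (2 - q) * ((B * s ^ 2) ^ ((q - 2) / 2) * w) := by
        rw [e1]; gcongr
    _ = (s ^ (2 - q) * s ^ (q - 2)) * (B ^ ((q - 2) / 2) * w) := by rw [e2]; ring
    _ = _ := by rw [e3, one_mul]

theorem noise_eq_noise_mul {Ω : Type*} {n : ℕ} (Z : Fin n → Ω → ℝ) (ρ : ℝ) {c : ℝ} (hc : c ≠ 0)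
    (a : Finset (Fin n) → ℝ) :
    noise ρ Z a = noise (c * ρ) Z (fun S => c⁻¹ ^ S.card * a S) := by
  funext ω
  refine Finset.sum_congr rfl fun S _ => ?_
  rw [← mul_assoc ((c * ρ) ^ S.card), ← mul_pow, mul_right_comm c, mul_inv_cancel₀ hc, one_mul]

theorem genDeriv_empty {Ω : Type*} {n : ℕ} (Z : Fin n → Ω → ℝ) (a : Finset (Fin n) → ℝ) :
    genDeriv ∅ Z a = multilin Z a := by
  funext ω
  simp [genDeriv, multilin]

/-! ### Bounds for the noise operator -/

section Noise

variable {Ω : Type*} [MeasurableSpace Ω] {μ : Measure Ω} [IsProbabilityMeasure μ]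
  {n : ℕ} {Z : Fin n → Ω → ℝ}

theorem eLpNorm_genDeriv_sq (hmeas : ∀ i, Measurable (Z i)) (hindep : iIndepFun Z μ)
    (hL2 : ∀ i, MemLp (Z i) 2 μ) (hmean : ∀ i, ∫ ω, Z i ω ∂μ = 0)
    (hvar : ∀ i, ∫ ω, Z i ω ^ 2 ∂μ = 1) (a : Finset (Fin n) → ℝ) (S : Finset (Fin n)) :
    eLpNorm (genDeriv S Z a) 2 μ ^ 2 = ENNReal.ofReal (∑ R with S ⊆ R, a R ^ 2) := by
  have hm : MemLp (genDeriv S Z a) 2 μ := by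
    rw [← ENNReal.ofReal_ofNat] at hL2 ⊢
    unfold genDeriv
    simpa using memLp_sum_prod_smul two_pos hmeas hindep hL2
      (Finset.univ.filter fun R => S ⊆ R) (fun R => R \ S) a (fun _ => (1 : ℝ))
  rw [eLpNorm_two_sq hm]
  congr 1
  refine integral_sum_prod_sq hmeas hindep hL2 hmean hvar (S := fun R => R \ S) ?_ a
  -- A superset `R` of `S` is recovered as `(R \ S) ∪ S`.
  intro R hR T hT h
  simp only [Finset.coe_filter, Finset.mem_univ, true_and, Set.mem_ofPred_eq] at hR hT
  rw [← Finset.sdiff_union_of_subset hR, ← Finset.sdiff_union_of_subset hT]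
  exact congrArg (· ∪ S) h

theorem eLpNorm_noise_rpow_le {q ρ : ℝ} (hq : 2 ≤ q) (hρ : |ρ| ≤ 1 / (2 * q ^ (3 / 2 : ℝ)))
    (hmeas : ∀ i, Measurable (Z i)) (hindep : iIndepFun Z μ)
    (hLq : ∀ i, MemLp (Z i) (ENNReal.ofReal q) μ) (hmean : ∀ i, ∫ ω, Z i ω ∂μ = 0)
    (hvar : ∀ i, ∫ ω, Z i ω ^ 2 ∂μ = 1) {σ : Fin n → ℝ} (hσ : ∀ i, 0 < σ i)
    (hσq : ∀ i, ∫ ω, |Z i ω| ^ q ∂μ ≤ σ i ^ (2 - q)) (a : Finset (Fin n) → ℝ) :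
    eLpNorm (noise ρ Z a) (ENNReal.ofReal q) μ ^ q ≤
      ENNReal.ofReal (∑ S : Finset (Fin n),
        (∏ i ∈ S, σ i) ^ (2 - q) * (∑ R with S ⊆ R, a R ^ 2) ^ (q / 2)) := by
  have hnoise : noise ρ Z a = fun ω => ∑ S ∈ (Finset.univ : Finset (Fin n)).powerset,
      (ρ ^ S.card * ∏ i ∈ S, Z i ω) • a S := by
    funext ω
    rw [Finset.powerset_univ]
    exact Finset.sum_congr rfl fun S _ => by rw [smul_eq_mul]; ring
  have hm : MemLp (noise ρ Z a) (ENNReal.ofReal q) μ := by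
    rw [hnoise]
    exact memLp_sum_prod_smul (by linarith) hmeas hindep hLq _ id (fun S => ρ ^ S.card) a
  rw [eLpNorm_ofReal_rpow (by linarith) hm, hnoise]
  refine ENNReal.ofReal_le_ofReal ((integral_norm_noise_rpow_le hq
    (two_mul_add_one_mul_le_one hq hρ) hmeas hindep hLq hmean hvar hσq Finset.univ a).trans
    (le_of_eq ?_))
  rw [Finset.powerset_univ]
  refine Finset.sum_congr rfl fun S _ => ?_
  rw [Real.finsetProd_rpow _ _ fun i _ => (hσ i).le]
  simp

theorem eLpNorm_noise_rpow_le_sum_genDeriv {q ρ : ℝ} (hq : 2 ≤ q)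
    (hρ : |ρ| ≤ 1 / (2 * q ^ (3 / 2 : ℝ)))
    (hmeas : ∀ i, Measurable (Z i)) (hindep : iIndepFun Z μ)
    (hLq : ∀ i, MemLp (Z i) (ENNReal.ofReal q) μ) (hmean : ∀ i, ∫ ω, Z i ω ∂μ = 0)
    (hvar : ∀ i, ∫ ω, Z i ω ^ 2 ∂μ = 1) {σ : Fin n → ℝ} (hσ : ∀ i, 0 < σ i)
    (hσq : ∀ i, ∫ ω, |Z i ω| ^ q ∂μ ≤ σ i ^ (2 - q)) (a : Finset (Fin n) → ℝ) :
    eLpNorm (noise ρ Z a) (ENNReal.ofReal q) μ ^ q ≤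
      ∑ S : Finset (Fin n), ENNReal.ofReal ((∏ i ∈ S, σ i) ^ (2 - q)) *
        eLpNorm (genDeriv S Z a) 2 μ ^ q := by
  have hL2 : ∀ i, MemLp (Z i) 2 μ := fun i => (hLq i).mono_exponent (by
    rw [← ENNReal.ofReal_ofNat]; exact ENNReal.ofReal_le_ofReal hq)
  have hs : ∀ S : Finset (Fin n), 0 < ∏ i ∈ S, σ i := fun S => Finset.prod_pos fun i _ => hσ i
  refine (eLpNorm_noise_rpow_le hq hρ hmeas hindep hLq hmean hvar hσ hσq a).trans (le_of_eq ?_)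
  have hW : ∀ S : Finset (Fin n), 0 ≤ ∑ R with S ⊆ R, a R ^ 2 := fun S =>
    Finset.sum_nonneg fun R _ => sq_nonneg _
  rw [ENNReal.ofReal_sum_of_nonneg fun S _ =>
    mul_nonneg (Real.rpow_nonneg (hs S).le _) (Real.rpow_nonneg (hW S) _)]
  refine Finset.sum_congr rfl fun S _ => ?_
  rw [ENNReal.ofReal_mul (Real.rpow_nonneg (hs S).le _), rpow_eq_ofReal_rpow_half (by linarith)
    (hW S) (eLpNorm_genDeriv_sq hmeas hindep hL2 hmean hvar a S)]

/-- Polynomials with small generalised influences satisfy a hypercontractive bound. -/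
theorem eLpNorm_noise_le_of_genInfluence_le {q ρ β : ℝ} (hq : 2 ≤ q)
    (hρ : |ρ| ≤ (2 * q) ^ (-(3 / 2) : ℝ)) (hβ : 0 < β)
    (hmeas : ∀ i, Measurable (Z i)) (hindep : iIndepFun Z μ)
    (hLq : ∀ i, MemLp (Z i) (ENNReal.ofReal q) μ) (hmean : ∀ i, ∫ ω, Z i ω ∂μ = 0)
    (hvar : ∀ i, ∫ ω, Z i ω ^ 2 ∂μ = 1) {σ : Fin n → ℝ} (hσ : ∀ i, 0 < σ i)
    (hσq : ∀ i, ∫ ω, |Z i ω| ^ q ∂μ ≤ σ i ^ (2 - q)) (a : Finset (Fin n) → ℝ)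
    (hinf : ∀ S : Finset (Fin n), genInfluence μ σ S Z a ≤
      ENNReal.ofReal β * eLpNorm (multilin Z a) 2 μ ^ 2) :
    eLpNorm (noise ρ Z a) (ENNReal.ofReal q) μ ≤
      ENNReal.ofReal (β ^ ((q - 2) / (2 * q))) * eLpNorm (multilin Z a) 2 μ := by
  have hq0 : 0 < q := by linarith
  have hL2 : ∀ i, MemLp (Z i) 2 μ := fun i => (hLq i).mono_exponent (by
    rw [← ENNReal.ofReal_ofNat]; exact ENNReal.ofReal_le_ofReal hq)
  have hs : ∀ S : Finset (Fin n), 0 < ∏ i ∈ S, σ i := fun S => Finset.prod_pos fun i _ => hσ i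
  have hD := eLpNorm_genDeriv_sq hmeas hindep hL2 hmean hvar a
  set N : ℝ := ∑ R, a R ^ 2 with hN
  have hN0 : 0 ≤ N := Finset.sum_nonneg fun R _ => sq_nonneg _
  have hf : eLpNorm (multilin Z a) 2 μ ^ 2 = ENNReal.ofReal N := by
    rw [← genDeriv_empty, hD]; simp [hN]
  have hW : ∀ S : Finset (Fin n), ∑ R with S ⊆ R, a R ^ 2 ≤ β * N * (∏ i ∈ S, σ i) ^ 2 := by
    intro S
    have h := hinf S
    have hW0 : 0 ≤ ∑ R with S ⊆ R, a R ^ 2 := Finset.sum_nonneg fun R _ => sq_nonneg _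
    have e : eLpNorm (fun ω => (∏ i ∈ S, σ i)⁻¹ * genDeriv S Z a ω) 2 μ =
        ‖(∏ i ∈ S, σ i)⁻¹‖ₑ * eLpNorm (genDeriv S Z a) 2 μ :=
      eLpNorm_const_smul (∏ i ∈ S, σ i)⁻¹ (genDeriv S Z a) 2 μ
    rw [genInfluence, e, mul_pow, hD, hf, Real.enorm_eq_ofReal (inv_pos.2 (hs S)).le,
      ← ENNReal.ofReal_pow (inv_pos.2 (hs S)).le, ← ENNReal.ofReal_mul (by positivity),
      ← ENNReal.ofReal_mul hβ.le, ENNReal.ofReal_le_ofReal_iff (by positivity), inv_pow,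
      inv_mul_le_iff₀ (pow_pos (hs S) 2)] at h
    linarith
  have hsq2 : ∀ k : ℕ, ((√2)⁻¹ ^ k) ^ 2 = (1 / 2 : ℝ) ^ k := fun k => by
    rw [← pow_mul, mul_comm, pow_mul, inv_pow, Real.sq_sqrt two_pos.le, one_div]
  have hbound : ∑ S : Finset (Fin n), (∏ i ∈ S, σ i) ^ (2 - q) *
      (∑ R with S ⊆ R, ((√2)⁻¹ ^ R.card * a R) ^ 2) ^ (q / 2) ≤
      β ^ ((q - 2) / 2) * N ^ (q / 2) := by
    simp only [mul_pow, hsq2]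
    calc _ ≤ ∑ S : Finset (Fin n), (β * N) ^ ((q - 2) / 2) *
          ∑ R with S ⊆ R, (1 / 2) ^ R.card * a R ^ 2 := by
          refine Finset.sum_le_sum fun S _ => rpow_two_sub_mul_rpow_half_le hq
            (Finset.sum_nonneg fun R _ => by positivity) (hs S) (by positivity)
            (le_trans (Finset.sum_le_sum fun R _ => ?_) (hW S))
          -- Damping only shrinks the weights, so the influence bound for the undamped coefficients
          -- still applies.
          exact mul_le_of_le_one_left (sq_nonneg _) (pow_le_one₀ (by norm_num) (by norm_num))
      _ = (β * N) ^ ((q - 2) / 2) * N := by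
          rw [← Finset.mul_sum, sum_sum_superset_half_pow]
      _ = _ := by
          rw [Real.mul_rpow hβ.le hN0, mul_assoc, ← Real.rpow_add_one' hN0 (by linarith)]
          congr 2; ring
  rw [← ENNReal.rpow_le_rpow_iff hq0, ENNReal.mul_rpow_of_nonneg _ _ hq0.le,
    rpow_eq_ofReal_rpow_half hq0.le hN0 hf, ENNReal.ofReal_rpow_of_nonneg (by positivity) hq0.le,
    ← Real.rpow_mul hβ.le, show (q - 2) / (2 * q) * q = (q - 2) / 2 by field_simp,
    ← ENNReal.ofReal_mul (by positivity),
    noise_eq_noise_mul Z ρ (Real.sqrt_ne_zero'.2 two_pos : √(2 : ℝ) ≠ 0) a]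
  exact (eLpNorm_noise_rpow_le hq (abs_sqrt_two_mul_le hq0 hρ) hmeas hindep hLq hmean hvar hσ hσq
    _).trans (ENNReal.ofReal_le_ofReal hbound)

end Noise

end GenHyper

theorem mainTheorem9 {Ω : Type*} [MeasurableSpace Ω] (μ : Measure Ω) [IsProbabilityMeasure μ]
    (n : ℕ) (q : ℝ) (hq : 2 ≤ q) (Z : Fin n → Ω → ℝ)
    (hmeas : ∀ i, Measurable (Z i))
    (hindep : iIndepFun Z μ)
    (hLq : ∀ i, MemLp (Z i) (ENNReal.ofReal q) μ)
    (hmean : ∀ i, ∫ ω, Z i ω ∂μ = 0)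
    (hvar : ∀ i, ∫ ω, Z i ω ^ 2 ∂μ = 1)
    (a : Finset (Fin n) → ℝ) :
    -- a common bound on the `q`-th moments
    (∀ σ : ℝ, 0 < σ → (∀ i, ∫ ω, |Z i ω| ^ q ∂μ ≤ σ ^ (2 - q)) →
      (∀ ρ : ℝ, |ρ| < 1 / (2 * q ^ (3 / 2 : ℝ)) →
        eLpNorm (GenHyper.noise ρ Z a) (ENNReal.ofReal q) μ ^ q ≤
          ∑ S : Finset (Fin n), ENNReal.ofReal (σ ^ ((2 - q) * (S.card : ℝ))) *
            eLpNorm (GenHyper.genDeriv S Z a) 2 μ ^ q) ∧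
      (∀ ρ β : ℝ, |ρ| ≤ (2 * q) ^ (-(3 / 2) : ℝ) → 0 < β →
        (∀ S : Finset (Fin n), GenHyper.genInfluence μ (fun _ => σ) S Z a ≤
          ENNReal.ofReal β * eLpNorm (GenHyper.multilin Z a) 2 μ ^ 2) →
        eLpNorm (GenHyper.noise ρ Z a) (ENNReal.ofReal q) μ ≤
          ENNReal.ofReal (β ^ ((q - 2) / (2 * q))) *
            eLpNorm (GenHyper.multilin Z a) 2 μ)) ∧
    -- individual bounds on the `q`-th moments
    (∀ σ : Fin n → ℝ, (∀ i, 0 < σ i) → (∀ i, ∫ ω, |Z i ω| ^ q ∂μ ≤ σ i ^ (2 - q)) →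
      (∀ ρ : ℝ, |ρ| ≤ (2 * q) ^ (-(3 / 2) : ℝ) →
        eLpNorm (GenHyper.noise ρ Z a) (ENNReal.ofReal q) μ ^ q ≤
          ∑ S : Finset (Fin n), ENNReal.ofReal ((∏ i ∈ S, σ i) ^ (2 - q)) *
            eLpNorm (GenHyper.genDeriv S Z a) 2 μ ^ q) ∧
      (∀ ρ β : ℝ, |ρ| ≤ (2 * q) ^ (-(3 / 2) : ℝ) → 0 < β →
        (∀ S : Finset (Fin n), GenHyper.genInfluence μ σ S Z a ≤
          ENNReal.ofReal β * eLpNorm (GenHyper.multilin Z a) 2 μ ^ 2) →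
        eLpNorm (GenHyper.noise ρ Z a) (ENNReal.ofReal q) μ ≤
          ENNReal.ofReal (β ^ ((q - 2) / (2 * q))) *
            eLpNorm (GenHyper.multilin Z a) 2 μ)) := by
  refine ⟨fun σ hσ hσq => ⟨fun ρ hρ => ?_, fun ρ β hρ hβ hinf => ?_⟩,
    fun σ hσ hσq => ⟨fun ρ hρ => ?_, fun ρ β hρ hβ hinf => ?_⟩⟩
  · refine (GenHyper.eLpNorm_noise_rpow_le_sum_genDeriv hq hρ.le hmeas hindep hLq hmean hvar
      (fun _ => hσ) hσq a).trans (le_of_eq (Finset.sum_congr rfl fun S _ => ?_))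
    rw [Finset.prod_const, ← Real.rpow_natCast, ← Real.rpow_mul hσ.le, mul_comm (S.card : ℝ)]
  · exact GenHyper.eLpNorm_noise_le_of_genInfluence_le hq hρ hβ hmeas hindep hLq hmean hvar
      (fun _ => hσ) hσq a hinf
  · exact GenHyper.eLpNorm_noise_rpow_le_sum_genDeriv hq
      (GenHyper.abs_le_of_abs_le_two_mul_rpow (by linarith) hρ) hmeas hindep hLq hmean hvar
      hσ hσq a
  · exact GenHyper.eLpNorm_noise_le_of_genInfluence_le hq hρ hβ hmeas hindep hLq hmean hvar
      hσ hσq a hinf
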